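/- Let $\mathbb S^2\subset\mathbb R^3$ be the unit sphere and, for $j\in\mathbb N_0$ and $-j\le k\le j$, let $$Y_j^k(\theta,\varphi)=\frac1{\sqrt{2\pi}}\sqrt{\frac{2j+1}{2}\,\frac{(j-k)!}{(j+k)!}}\;P_{j,k}(\cos\theta)\,e^{ik\varphi}$$ be the spherical harmonics, where $\theta$ is the colatitude, $\varphi$ the longitude, and $P_{j,k}$ the associated Legendre functions with the Condon–Shortley sign: with $P_j$ the Legendre polynomial, $P_{j,m}(x)=(-1)^m(1-x^2)^{m/2}\frac{d^m}{dx^m}P_j(x)$ and $P_{j,-m}=(-1)^m\frac{(j-m)!}{(j+m)!}P_{j,m}$ for $0\le m\le j$. Let $K:\mathbb S^2\times\mathbb S^2\to\mathbb C$ be continuous and Hermitian, i.e. $K(\xi,\zeta)=\overline{K(\zeta,\xi)}$, and suppose that there are complex numbers $d_j(k,k')$ with $$K(\xi,\zeta)=\sum_{j=0}^\infty\sum_{k=-j}^{j}\sum_{k'=-j}^{j}d_j(k,k')\,Y_j^k(\xi)\,\overline{Y_j^{k'}(\zeta)}\qquad\text{for all }\xi,\zeta\in\mathbb S^2,$$ the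 series over $j$ converging pointwise. Let $D_j$ be the linear operator on $\mathbb C^{2j+1}$ (coordinates indexed by $-j,\dots,j$) given by $(D_jx)_{k'}=\sum_{k=-j}^{j}d_j(k,k')x_k$. An operator $P$ on a finite-dimensional complex Hilbert space is called positive (strictly positive) if it is self-adjoint and $\langle Px,x\rangle\ge0$ for all $x$ (respectively $\langle Px,x\rangle>0$ for all $x\ne0$). The kernel $K$ is called strictly positive definite if for every finite set $\Xi\subset\mathbb S^2$ of distinct points the matrix $(K(\xi,\zeta))_{\xi,\zeta\in\Xi}$ induces, by left multiplication, a strictly positive operator on $\mathbb C^{|\Xi|}$. Let $\mathcal F$ be the set of all $j\in\mathbb N_0$ for which $D_j$ is strictly positive. (Lemma 4) If $D_j$ is positive for every $j\in\mathbb N_0$, and if for every finite set $\Xi\subset\mathbb S^2$ of distinct points and all complex coefficients $(c_\xi)_{\xi\in\Xi}$ $$\sum_{\xi\in\Xi}c_\xi Y_j^k(\xi)=0\quad\text{for all }j\in\mathcal F\text{ and }k=-j,\dots,j\qquad\Longrightarrow\qquad c_\xi=0\quad\text{for all }\xi\in\Xi,$$ then $K$ is strictly positive definite. (Proposition 1)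 If $D_j$ is strictly positive for every $j\in\mathbb N_0$, then $K$ is strictly positive definite. -/

import Mathlib

open scoped ComplexConjugate

noncomputable section

namespace SphKernel

/-- The unit sphere of three-dimensional Euclidean space. -/
abbrev S2 : Type := Metric.sphere (0 : EuclideanSpace ℝ (Fin 3)) 1

/-- A strictly positive operator on a complex Hilbert space: bounded, self-adjoint, and with
`⟨P x, x⟩ > 0` for every `x ≠ 0` (these inner products are real because `P` is self-adjoint).
Positive operators are Mathlib's `ContinuousLinearMap.IsPositive`. -/
def IsStrictlyPositiveOp {H : Type*} [NormedAddCommGroup H] [InnerProductSpace ℂ H]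
    [CompleteSpace H] (P : H →L[ℂ] H) : Prop :=
  IsSelfAdjoint P ∧ ∀ x : H, x ≠ 0 → 0 < (inner ℂ (P x) x).re

/-- The operator on `ℂ^Ξ` given by left multiplication with the matrix
`(K(ξ, ζ))_{ξ, ζ ∈ Ξ}`. -/
def kernelOp (K : S2 → S2 → ℂ) (Ξ : Finset S2) :
    EuclideanSpace ℂ Ξ →L[ℂ] EuclideanSpace ℂ Ξ :=
  open Classical in
  Matrix.toEuclideanCLM (n := Ξ) (𝕜 := ℂ) (Matrix.of fun ξ ζ : Ξ => K ξ ζ)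

/-- The kernel `K(ξ, ζ)` equals the complex conjugate of `K(ζ, ξ)`. -/
def IsHermitianKernel (K : S2 → S2 → ℂ) : Prop :=
  ∀ ξ ζ : S2, K ξ ζ = conj (K ζ ξ)

/-- Strict positive definiteness of a kernel: the matrix of every finite set of distinct points
induces a strictly positive operator. -/
def IsStrictlyPositiveDefinite (K : S2 → S2 → ℂ) : Prop :=
  ∀ Ξ : Finset S2, IsStrictlyPositiveOp (kernelOp K Ξ)

/-- The Legendre polynomial `P_j`, by the formula of Rodrigues. -/
def legendre (j : ℕ) : Polynomial ℝ :=
  Polynomial.C (1 / ((2 : ℝ) ^ j * (j.factorial : ℝ))) *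
    Polynomial.derivative^[j] ((Polynomial.X ^ 2 - 1) ^ j)

/-- The associated Legendre function `P_{j,m}` on `[-1, 1]` of nonnegative order `m`,
with the Condon–Shortley sign: `(-1)^m (1 - x²)^{m/2} (d/dx)^m P_j(x)`. -/
def assocLegendreNat (j m : ℕ) (x : ℝ) : ℝ :=
  (-1) ^ m * (√(1 - x ^ 2)) ^ m * (Polynomial.derivative^[m] (legendre j)).eval x

/-- The associated Legendre function `P_{j,k}` on `[-1, 1]` of order `k`, for `-j ≤ k ≤ j`;
for negative orders `P_{j,-m} = (-1)^m (j-m)!/(j+m)! P_{j,m}`. -/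
def assocLegendre (j : ℕ) (k : ℤ) (x : ℝ) : ℝ :=
  if 0 ≤ k then assocLegendreNat j k.natAbs x
  else (-1) ^ k.natAbs * (((j - k.natAbs).factorial : ℝ) / ((j + k.natAbs).factorial : ℝ)) *
    assocLegendreNat j k.natAbs x

/-- The spherical harmonic `Y_j^k` (for `-j ≤ k ≤ j`) in polar coordinates: `θ` is the
colatitude and `φ` the longitude. -/
def sphHarmPolar (j : ℕ) (k : ℤ) (θ φ : ℝ) : ℂ :=
  ((1 / √(2 * Real.pi) *
      √((2 * (j : ℝ) + 1) / 2 *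
        ((((j : ℤ) - k).toNat.factorial : ℝ) / (((j : ℤ) + k).toNat.factorial : ℝ))) *
      assocLegendre j k (Real.cos θ) : ℝ) : ℂ) *
    Complex.exp (Complex.I * (k : ℂ) * (φ : ℂ))

/-- The spherical harmonic `Y_j^k` as a function on the sphere. At the two poles, where the
longitude is undetermined, the value of `sphHarmPolar` does not depend on it. -/
def sphHarm (j : ℕ) (k : ℤ) (ξ : S2) : ℂ :=
  sphHarmPolar j k (Real.arccos (ξ.1 2)) (Complex.arg ⟨ξ.1 0, ξ.1 1⟩)

/-- The kernel is the pointwise sum of the series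
`∑_j ∑_{k,k'=-j}^{j} d_j(k,k') Y_j^k(ξ) conj(Y_j^{k'}(ζ))`, as the limit of the partial sums
over `j < N`. The numbers `d j k k'` with `|k| > j` or `|k'| > j` play no role. -/
def HasBlockExpansion (K : S2 → S2 → ℂ) (d : ℕ → ℤ → ℤ → ℂ) : Prop :=
  ∀ ξ ζ : S2, Filter.Tendsto
    (fun N : ℕ => ∑ j ∈ Finset.range N,
      ∑ k ∈ Finset.Icc (-(j : ℤ)) j, ∑ k' ∈ Finset.Icc (-(j : ℤ)) j,
        d j k k' * sphHarm j k ξ * conj (sphHarm j k' ζ))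
    Filter.atTop (nhds (K ξ ζ))

/-- The operator `D_j` on `ℂ^{2j+1}`, with coordinates indexed by `-j ≤ k ≤ j`:
`(D_j x)_{k'} = ∑_k d_j(k,k') x_k`. -/
def blockOp (d : ℕ → ℤ → ℤ → ℂ) (j : ℕ) :
    EuclideanSpace ℂ (Finset.Icc (-(j : ℤ)) j) →L[ℂ]
      EuclideanSpace ℂ (Finset.Icc (-(j : ℤ)) j) :=
  Matrix.toEuclideanCLM (n := Finset.Icc (-(j : ℤ)) j) (𝕜 := ℂ)
    (Matrix.of fun k' k : Finset.Icc (-(j : ℤ)) j => d j k k')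

/-- The set `F` of all indices `j` for which `D_j` is strictly positive. -/
def strictIndices (d : ℕ → ℤ → ℤ → ℂ) : Set ℕ :=
  {j | IsStrictlyPositiveOp (blockOp d j)}

end SphKernel

end

/-!
Write `w = x + i y` for a point `(x, y, z)` of the sphere.

Positivity: for coefficients `c` on a finite set `Ξ`, the quadratic form of the matrix of `K` is the
limit of the partial sums of `⟨D_j a_j, a_j⟩` with `(a_j)_k = ∑_ξ conj (c_ξ) Y_j^k(ξ)`
(`re_inner_kernelOp_tendsto`). These terms are nonnegative, so if the form vanishes then every
term does, and strict positivity of `D_j` gives `a_j = 0` for all `j ∈ F`; the hypothesis on `F`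
then forces `c = 0`.

Completeness of the full system: if every `D_j` is strictly positive, then `F = ℕ`, and the
hypothesis on `F` holds outright. Only the orders `m ≥ 0` are needed for this. By
`sphHarm_natCast` the function `Y_j^m` is a nonzero multiple of `w^m P_j^{(m)}(z)`, and
for fixed `m` the polynomials `P_j^{(m)}`, `j ≥ m`, have the degrees `0, 1, 2, …`, so they span
all polynomials. Hence coefficients orthogonal to all `Y_j^m` are orthogonal to all products
`p(w) q(z)`, and such products interpolate at finitely many points, because `(w, z)` determines the
point (`eq_zero_of_sum_mul_sphHarm_eq_zero`).
-/

open scoped ComplexConjugate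

namespace SphKernel

open Polynomial

/-- The complex coordinate `x + i y` of a point `(x, y, z)` of the sphere. -/
def planar (ξ : S2) : ℂ := ⟨ξ.1 0, ξ.1 1⟩

lemma sum_sq_eq_one (ξ : S2) : ξ.1 0 ^ 2 + ξ.1 1 ^ 2 + ξ.1 2 ^ 2 = 1 := by
  have h : ‖ξ.1‖ = 1 := by simp
  have h2 := EuclideanSpace.real_norm_sq_eq ξ.1
  rw [h, Fin.sum_univ_three] at h2
  linarith

lemma norm_planar (ξ : S2) : ‖planar ξ‖ = √(1 - ξ.1 2 ^ 2) := by
  rw [Complex.norm_def, Complex.normSq_apply]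
  congr 1
  simp only [planar]
  linarith [sum_sq_eq_one ξ]

lemma ext_planar {ξ ζ : S2} (h : planar ξ = planar ζ) (h2 : ξ.1 2 = ζ.1 2) : ξ = ζ := by
  have hre := congrArg Complex.re h
  have him := congrArg Complex.im h
  apply Subtype.ext
  ext i
  fin_cases i
  · exact hre
  · exact him
  · exact h2

lemma degree_iterate_derivative {p : ℝ[X]} {n k : ℕ} (hp : p.degree = (n + k : ℕ)) :
    (derivative^[k] p).degree = n := by
  induction k generalizing p with
  | zero => simpa using hp
  | succ k ih =>
    rw [Function.iterate_succ_apply]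
    apply ih
    have hn : p.natDegree = n + k + 1 := natDegree_eq_of_degree_eq_some hp
    rw [degree_derivative (by omega), hn]
    rfl

lemma degree_legendre (j : ℕ) : (legendre j).degree = j := by
  have hc : (1 / ((2 : ℝ) ^ j * (j.factorial : ℝ))) ≠ 0 := by positivity
  rw [legendre, degree_C_mul hc]
  apply degree_iterate_derivative
  have h : (X ^ 2 - 1 : ℝ[X]).degree = 2 := degree_X_pow_sub_C (n := 2) (by norm_num) (1 : ℝ)
  rw [degree_pow, h]
  rw [nsmul_eq_mul]
  norm_cast
  omega

/-- For a fixed order `m`, the derivatives `P_{m+i}^{(m)}`, which have degree `i`. -/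
noncomputable def legendreDerivSequence (m : ℕ) : Polynomial.Sequence ℝ where
  elems' i := derivative^[m] (legendre (m + i))
  degree_eq' i := degree_iterate_derivative (by rw [degree_legendre, add_comm])

/-- The factor `√(1 - z²)^m e^{imφ}` of the spherical harmonic is `w^m`; at the poles this is the
vanishing of `w`, where the longitude is a junk value. -/
lemma sphHarm_natCast (m i : ℕ) :
    ∃ C : ℂ, C ≠ 0 ∧ ∀ ξ : S2, sphHarm (m + i) m ξ =
      C * (planar ξ ^ m * ((legendreDerivSequence m i).eval (ξ.1 2) : ℝ)) := by
  refine ⟨((1 / √(2 * Real.pi) *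
      √((2 * ((m + i : ℕ) : ℝ) + 1) / 2 *
        (((((m + i : ℕ) : ℤ) - m).toNat.factorial : ℝ) /
          ((((m + i : ℕ) : ℤ) + m).toNat.factorial : ℝ))) * (-1) ^ m : ℝ) : ℂ), ?_, fun ξ => ?_⟩
  · rw [Complex.ofReal_ne_zero]
    positivity
  · have hz := sum_sq_eq_one ξ
    have hcos : Real.cos (Real.arccos (ξ.1 2)) = ξ.1 2 :=
      Real.cos_arccos (by nlinarith) (by nlinarith)
    have hw : planar ξ ^ m = ((√(1 - ξ.1 2 ^ 2) : ℝ) : ℂ) ^ m *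
        Complex.exp (Complex.I * m * (planar ξ).arg) := by
      conv_lhs => rw [← Complex.norm_mul_exp_arg_mul_I (planar ξ), mul_pow, ← Complex.exp_nat_mul,
        norm_planar]
      ring_nf
    have hS : (legendreDerivSequence m i : ℝ[X]) = derivative^[m] (legendre (m + i)) := rfl
    rw [hw, hS, sphHarm, sphHarmPolar, hcos, assocLegendre, if_pos (Int.natCast_nonneg m),
      Int.natAbs_natCast, assocLegendreNat]
    simp only [planar]
    push_cast
    ring

/-- The vanishing on all `Y_{m+i}^m` extends to `w^m q(z)` because the sequence of degrees
`0, 1, 2, …` spans all polynomials `q`. -/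
lemma sum_mul_planar_pow_mul_eval {Ξ : Finset S2} {c : Ξ → ℂ}
    (h : ∀ j : ℕ, ∀ k ∈ Finset.Icc (-(j : ℤ)) j, ∑ ξ : Ξ, c ξ * sphHarm j k ξ = 0)
    (m : ℕ) (q : ℝ[X]) :
    ∑ ξ : Ξ, c ξ * (planar ξ ^ m * ((q.eval (ξ.1.1 2) : ℝ) : ℂ)) = 0 := by
  have hq : q ∈ Submodule.span ℝ (Set.range (legendreDerivSequence m)) := by
    rw [Polynomial.Sequence.span _ fun i => ?_]
    · trivial
    · exact (leadingCoeff_ne_zero.2 ((legendreDerivSequence m).ne_zero i)).isUnit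
  induction hq using Submodule.span_induction with
  | mem q hq =>
    obtain ⟨i, rfl⟩ := hq
    obtain ⟨C, hC, hY⟩ := sphHarm_natCast m i
    have h0 := h (m + i) m (by simp only [Finset.mem_Icc]; omega)
    simp only [hY, mul_left_comm _ C] at h0
    rw [← Finset.mul_sum] at h0
    exact (mul_eq_zero.1 h0).resolve_left hC
  | zero => simp
  | add p q _ _ hp hq =>
    simp only [eval_add, Complex.ofReal_add, mul_add, Finset.sum_add_distrib, hp, hq, add_zero]
  | smul a q _ hq =>
    have : ∀ ξ : Ξ, c ξ * (planar ξ ^ m * (((a • q).eval (ξ.1.1 2) : ℝ) : ℂ)) =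
        a * (c ξ * (planar ξ ^ m * ((q.eval (ξ.1.1 2) : ℝ) : ℂ))) := fun ξ => by
      rw [eval_smul, smul_eq_mul]
      push_cast
      ring
    simp only [this, ← Finset.mul_sum, hq, mul_zero]

lemma sum_mul_eval_planar_mul_eval {Ξ : Finset S2} {c : Ξ → ℂ}
    (h : ∀ j : ℕ, ∀ k ∈ Finset.Icc (-(j : ℤ)) j, ∑ ξ : Ξ, c ξ * sphHarm j k ξ = 0)
    (p : ℂ[X]) (q : ℝ[X]) :
    ∑ ξ : Ξ, c ξ * (p.eval (planar ξ) * ((q.eval (ξ.1.1 2) : ℝ) : ℂ)) = 0 := by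
  simp only [eval_eq_sum_range, Finset.sum_mul, Finset.mul_sum]
  rw [Finset.sum_comm]
  refine Finset.sum_eq_zero fun m _ => ?_
  rw [← mul_zero (p.coeff m), ← sum_mul_planar_pow_mul_eval h m q, Finset.mul_sum]
  simp only [eval_eq_sum_range]
  refine Finset.sum_congr rfl fun ξ _ => ?_
  ring

/-- The spherical harmonics of all degrees separate finitely supported coefficients. -/
lemma eq_zero_of_sum_mul_sphHarm_eq_zero {Ξ : Finset S2} {c : Ξ → ℂ}
    (h : ∀ j : ℕ, ∀ k ∈ Finset.Icc (-(j : ℤ)) j, ∑ ξ : Ξ, c ξ * sphHarm j k ξ = 0)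
    (ξ₀ : Ξ) : c ξ₀ = 0 := by
  classical
  -- `p(w) q(z)` vanishes at every point of `Ξ` but `ξ₀`: each other point differs from `ξ₀` in
  -- `w` or in `z`.
  let p : ℂ[X] := ∏ w ∈ (Finset.univ.image fun ξ : Ξ => planar ξ).erase (planar ξ₀), (X - C w)
  let q : ℝ[X] := ∏ z ∈ (Finset.univ.image fun ξ : Ξ => ξ.1.1 2).erase (ξ₀.1.1 2), (X - C z)
  have hp : p.eval (planar ξ₀) ≠ 0 := by
    rw [eval_prod, Finset.prod_ne_zero_iff]
    intro w hw
    rw [eval_sub, eval_X, eval_C, sub_ne_zero]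
    exact (Finset.ne_of_mem_erase hw).symm
  have hq : q.eval (ξ₀.1.1 2) ≠ 0 := by
    rw [eval_prod, Finset.prod_ne_zero_iff]
    intro z hz
    rw [eval_sub, eval_X, eval_C, sub_ne_zero]
    exact (Finset.ne_of_mem_erase hz).symm
  have hsum := sum_mul_eval_planar_mul_eval h p q
  rw [Finset.sum_eq_single ξ₀ (fun ξ _ hξ => ?_) (by simp)] at hsum
  · simpa [hp, hq] using hsum
  · by_cases hw : planar ξ = planar ξ₀
    · have hz : ξ.1.1 2 ≠ ξ₀.1.1 2 := fun hz => hξ (Subtype.ext (ext_planar hw hz))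
      have : q.eval (ξ.1.1 2) = 0 := by
        rw [eval_prod]
        exact Finset.prod_eq_zero (Finset.mem_erase.2
          ⟨hz, Finset.mem_image_of_mem (fun ξ : Ξ => ξ.1.1 2) (Finset.mem_univ ξ)⟩) (by simp)
      simp [this]
    · have : p.eval (planar ξ) = 0 := by
        rw [eval_prod]
        exact Finset.prod_eq_zero (Finset.mem_erase.2
          ⟨hw, Finset.mem_image_of_mem (fun ξ : Ξ => planar ξ) (Finset.mem_univ ξ)⟩) (by simp)
      simp [this]

/-- Mathlib's inner product is conjugate linear in the first slot, whence the outer conjugate. -/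
lemma inner_toEuclideanCLM_self {n : Type*} [Fintype n] [DecidableEq n] (A : Matrix n n ℂ)
    (x : EuclideanSpace ℂ n) :
    inner ℂ (Matrix.toEuclideanCLM (n := n) (𝕜 := ℂ) A x) x =
      conj (∑ i, ∑ l, A i l * x l * conj (x i)) := by
  simp only [PiLp.inner_apply, Matrix.ofLp_toEuclideanCLM, Matrix.mulVec, dotProduct,
    RCLike.inner_apply, map_sum, map_mul, Finset.mul_sum, RCLike.conj_conj]
  refine Finset.sum_congr rfl fun i _ => Finset.sum_congr rfl fun l _ => ?_
  ring

/-- The coordinate vector `k ↦ ∑_ξ conj (c_ξ) Y_j^k(ξ)` of degree `j`. -/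
noncomputable def harmVec {Ξ : Finset S2} (c : EuclideanSpace ℂ Ξ) (j : ℕ) :
    EuclideanSpace ℂ (Finset.Icc (-(j : ℤ)) j) :=
  WithLp.toLp 2 fun k => ∑ ξ : Ξ, conj (c ξ) * sphHarm j k ξ

lemma re_inner_blockOp_harmVec (d : ℕ → ℤ → ℤ → ℂ) {Ξ : Finset S2} (c : EuclideanSpace ℂ Ξ)
    (j : ℕ) :
    (inner ℂ (blockOp d j (harmVec c j)) (harmVec c j)).re =
      (∑ ξ : Ξ, ∑ ζ : Ξ, conj (c ξ) * c ζ *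
        ∑ k ∈ Finset.Icc (-(j : ℤ)) j, ∑ k' ∈ Finset.Icc (-(j : ℤ)) j,
          d j k k' * sphHarm j k ξ * conj (sphHarm j k' ζ)).re := by
  rw [blockOp, inner_toEuclideanCLM_self, Complex.conj_re]
  congr 1
  have hsub : ∀ f : ℤ → ℂ, ∑ k ∈ Finset.Icc (-(j : ℤ)) j, f k =
      ∑ k : Finset.Icc (-(j : ℤ)) j, f k := fun f => (Finset.sum_coe_sort _ f).symm
  simp only [hsub, Finset.mul_sum]
  let F (k k' : Finset.Icc (-(j : ℤ)) j) (ξ ζ : Ξ) : ℂ :=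
    conj (c ξ) * c ζ * (d j k k' * sphHarm j k ξ * conj (sphHarm j k' ζ))
  calc
    _ = ∑ k', ∑ k, ∑ ξ, ∑ ζ, F k k' ξ ζ := by
      refine Finset.sum_congr rfl fun k' _ => Finset.sum_congr rfl fun k _ => ?_
      simp only [harmVec, Matrix.of_apply, map_sum, map_mul, Complex.conj_conj]
      rw [mul_assoc, Finset.sum_mul_sum, Finset.mul_sum]
      refine Finset.sum_congr rfl fun ξ _ => ?_
      rw [Finset.mul_sum]
      refine Finset.sum_congr rfl fun ζ _ => ?_
      simp only [F]
      ring
    _ = ∑ k, ∑ k', ∑ ξ, ∑ ζ, F k k' ξ ζ := Finset.sum_comm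
    _ = ∑ k, ∑ ξ, ∑ k', ∑ ζ, F k k' ξ ζ := Finset.sum_congr rfl fun _ _ => Finset.sum_comm
    _ = ∑ ξ, ∑ k, ∑ k', ∑ ζ, F k k' ξ ζ := Finset.sum_comm
    _ = ∑ ξ, ∑ k, ∑ ζ, ∑ k', F k k' ξ ζ := Finset.sum_congr rfl fun _ _ =>
      Finset.sum_congr rfl fun _ _ => Finset.sum_comm
    _ = ∑ ξ, ∑ ζ, ∑ k, ∑ k', F k k' ξ ζ := Finset.sum_congr rfl fun _ _ => Finset.sum_comm

lemma re_inner_kernelOp_tendsto {K : S2 → S2 → ℂ} {d : ℕ → ℤ → ℤ → ℂ}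
    (hform : HasBlockExpansion K d) {Ξ : Finset S2} (c : EuclideanSpace ℂ Ξ) :
    Filter.Tendsto (fun N : ℕ => ∑ j ∈ Finset.range N,
        (inner ℂ (blockOp d j (harmVec c j)) (harmVec c j)).re)
      Filter.atTop (nhds (inner ℂ (kernelOp K Ξ c) c).re) := by
  have hK : (inner ℂ (kernelOp K Ξ c) c).re =
      (∑ ξ : Ξ, ∑ ζ : Ξ, conj (c ξ) * c ζ * K ξ ζ).re := by
    rw [kernelOp, inner_toEuclideanCLM_self, Complex.conj_re]
    congr 1
    refine Finset.sum_congr rfl fun ξ _ => Finset.sum_congr rfl fun ζ _ => ?_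
    rw [Matrix.of_apply]
    ring
  have hlim := tendsto_finsetSum Finset.univ fun (ξ : Ξ) _ =>
    tendsto_finsetSum Finset.univ fun (ζ : Ξ) _ =>
      (hform ξ ζ).const_mul (conj (c ξ) * c ζ)
  rw [hK]
  refine Filter.Tendsto.congr (fun N => ?_) ((Complex.continuous_re.tendsto _).comp hlim)
  simp only [Function.comp_apply, re_inner_blockOp_harmVec, ← Complex.re_sum]
  congr 1
  symm
  rw [Finset.sum_comm]
  refine Finset.sum_congr rfl fun ξ _ => ?_
  rw [Finset.sum_comm]
  refine Finset.sum_congr rfl fun ζ _ => ?_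
  rw [Finset.mul_sum]

lemma isSelfAdjoint_kernelOp {K : S2 → S2 → ℂ} (hherm : IsHermitianKernel K) (Ξ : Finset S2) :
    IsSelfAdjoint (kernelOp K Ξ) := by
  classical
  rw [IsSelfAdjoint, kernelOp, ← map_star]
  congr 1
  ext ξ ζ
  exact (hherm ξ ζ).symm

lemma isStrictlyPositiveDefinite_of_isPositive {K : S2 → S2 → ℂ} {d : ℕ → ℤ → ℤ → ℂ}
    (hherm : IsHermitianKernel K) (hform : HasBlockExpansion K d)
    (hpos : ∀ j : ℕ, (blockOp d j).IsPositive)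
    (hind : ∀ (Ξ : Finset S2) (c : Ξ → ℂ),
      (∀ j ∈ strictIndices d, ∀ k ∈ Finset.Icc (-(j : ℤ)) j,
        ∑ ξ : Ξ, c ξ * sphHarm j k ξ = 0) → ∀ ξ : Ξ, c ξ = 0) :
    IsStrictlyPositiveDefinite K := by
  refine fun Ξ => ⟨isSelfAdjoint_kernelOp hherm Ξ, fun c hc => ?_⟩
  have hterm : ∀ j, 0 ≤ (inner ℂ (blockOp d j (harmVec c j)) (harmVec c j)).re := fun j =>
    (hpos j).re_inner_nonneg_left _
  have hlim := re_inner_kernelOp_tendsto hform c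
  have hle := fun j =>
    le_hasSum ((hasSum_iff_tendsto_nat_of_nonneg hterm _).2 hlim) j fun i _ => hterm i
  by_contra hcon
  refine hc ?_
  have hconj : ∀ ξ : Ξ, conj (c ξ) = 0 := by
    refine hind Ξ (fun ξ => conj (c ξ)) fun j hj k hk => ?_
    have hx : harmVec c j = 0 := by
      by_contra hne
      exact hcon ((hj.2 _ hne).trans_le (hle j))
    exact congrArg (fun x : EuclideanSpace ℂ (Finset.Icc (-(j : ℤ)) j) => x ⟨k, hk⟩) hx
  ext ξ
  simpa using hconj ξ

lemma IsStrictlyPositiveOp.isPositive {H : Type*} [NormedAddCommGroup H] [InnerProductSpace ℂ H]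
    [CompleteSpace H] {P : H →L[ℂ] H} (hP : IsStrictlyPositiveOp P) : P.IsPositive := by
  refine ContinuousLinearMap.isPositive_def'.2 ⟨hP.1, fun x => ?_⟩
  rcases eq_or_ne x 0 with rfl | hx
  · simp [ContinuousLinearMap.reApplyInnerSelf]
  · exact (hP.2 x hx).le

end SphKernel

theorem lemma4 (K : SphKernel.S2 → SphKernel.S2 → ℂ) (d : ℕ → ℤ → ℤ → ℂ)
    (hcont : Continuous fun p : SphKernel.S2 × SphKernel.S2 => K p.1 p.2)
    (hherm : SphKernel.IsHermitianKernel K)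
    (hform : SphKernel.HasBlockExpansion K d) :
    ((∀ j : ℕ, (SphKernel.blockOp d j).IsPositive) →
      (∀ (Ξ : Finset SphKernel.S2) (c : Ξ → ℂ),
        (∀ j ∈ SphKernel.strictIndices d, ∀ k ∈ Finset.Icc (-(j : ℤ)) j,
          ∑ ξ : Ξ, c ξ * SphKernel.sphHarm j k ξ = 0) →
        ∀ ξ : Ξ, c ξ = 0) →
      SphKernel.IsStrictlyPositiveDefinite K) ∧
    ((∀ j : ℕ, SphKernel.IsStrictlyPositiveOp (SphKernel.blockOp d j)) →
      SphKernel.IsStrictlyPositiveDefinite K) := by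

  refine ⟨SphKernel.isStrictlyPositiveDefinite_of_isPositive hherm hform, fun hstrict => ?_⟩
  exact SphKernel.isStrictlyPositiveDefinite_of_isPositive hherm hform
    (fun j => (hstrict j).isPositive)
    fun _ _ h => SphKernel.eq_zero_of_sum_mul_sphHarm_eq_zero fun j => h j (hstrict j)
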